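/- Let $d\ge 2$ and let $\Omega\subset\mathbb{R}^d$ be a domain (an open connected set) with $0\in\Omega$. Let $\theta_1,\theta_2\in\mathbb{R}^d$ be unit vectors with $\arccos\langle\theta_1,\theta_2\rangle\notin\pi\mathbb{Q}$, and let $\theta_j^\perp=\{x\in\mathbb{R}^d:\langle x,\theta_j\rangle=0\}$. Let $k\in\mathbb{R}$ and let $u$ be a (real- or complex-valued) classical $C^2$ solution on $\Omega$ of the Laplace--Helmholtz equation $$\Delta u+k^2u=0 .$$ Suppose that $u$ satisfies one of the following two pairs of conditions: (i) $u=0$ on $\theta_1^\perp\cap\Omega$ and $u=0$ on $\theta_2^\perp\cap\Omega$; or (ii) $u=0$ on $\theta_1^\perp\cap\Omega$ and $\partial_n u=0$ on $\theta_2^\perp\cap\Omega$, where $\partial_n u(x)$ is the derivative of $u$ at $x$ in the unit normal direction $\theta_2$. Then $u=0$ on $\Omega$. -/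

import Mathlib

open scoped InnerProductSpace

/-! The function U(x, s) = exp(k s) u(x) is harmonic in one more dimension. The two hyperplanes lift
to hyperplanes at the same angle and the boundary conditions lift too, so it suffices to treat
harmonic functions.

A harmonic function is odd across a hyperplane where it vanishes and even across one where its
normal derivative vanishes. Hence near 0 its zero set is invariant under both reflections, and so
under their product, a rotation by twice the angle α in the plane of the normals. As α / π is
irrational, orbits are dense in each circle parallel to that plane; each circle meets the first
hyperplane, where U = 0, so continuity gives U = 0 near 0 (`eq_zero_of_reflection_irrational`).
Unique continuation spreads this over the connected domain.

Reflection and unique continuation both rest on `exists_ray_eq_zero`, a quantitative form of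
analyticity: averaging against a radial bump gives smoothness and an interior gradient estimate,
iteration gives derivative bounds (C m / R)^m M, and Taylor's bound with m^m / m! ≤ e^m shows that
vanishing of all derivatives along a direction forces vanishing on a segment whose length is a fixed
fraction of R. For the reflections, f ± f ∘ σ has zero Cauchy data on the hyperplane, and
harmonicity propagates this to all normal derivatives. -/

section

open MeasureTheory Metric Set Filter Topology

/-! ### A smooth radial bump and its potential -/

section RadialBump

variable {V : Type*} [NormedAddCommGroup V]

/-- A smooth radial function supported in the closed unit ball. -/
noncomputable def bumpPotential (y : V) : ℝ := expNegInvGlue (1 - ‖y‖ ^ 2)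

/-- The radial bump whose product with the identity is minus the gradient of `bumpPotential`. -/
noncomputable def radialBump (y : V) : ℝ := 2 * deriv expNegInvGlue (1 - ‖y‖ ^ 2)

lemma contDiff_deriv_expNegInvGlue {n : ℕ∞} : ContDiff ℝ n (deriv expNegInvGlue) := by
  have h : ContDiff ℝ ((⊤ : ℕ∞) : WithTop ℕ∞) expNegInvGlue := expNegInvGlue.contDiff
  exact (contDiff_infty_iff_deriv.1 h).2.of_le (by exact_mod_cast le_top)

/-- Such points are global minima of the nonnegative function `expNegInvGlue`. -/
lemma deriv_expNegInvGlue_of_nonpos {x : ℝ} (hx : x ≤ 0) : deriv expNegInvGlue x = 0 := by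
  apply IsLocalMin.deriv_eq_zero
  filter_upwards with y
  rw [expNegInvGlue.zero_of_nonpos hx]
  exact expNegInvGlue.nonneg y

lemma bumpPotential_eq_zero {y : V} (hy : 1 ≤ ‖y‖) : bumpPotential y = 0 :=
  expNegInvGlue.zero_of_nonpos (by nlinarith)

lemma radialBump_eq_zero {y : V} (hy : 1 ≤ ‖y‖) : radialBump y = 0 := by
  rw [radialBump, deriv_expNegInvGlue_of_nonpos (by nlinarith), mul_zero]

lemma radialBump_nonneg (y : V) : 0 ≤ radialBump y :=
  mul_nonneg zero_le_two expNegInvGlue.monotone.deriv_nonneg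

lemma radialBump_zero_pos : 0 < radialBump (0 : V) := by
  have h : expNegInvGlue =ᶠ[𝓝 1] fun x => Real.exp (-x⁻¹) := by
    filter_upwards [lt_mem_nhds (zero_lt_one (α := ℝ))] with x hx
    simp [expNegInvGlue, hx]
  have h2 : HasDerivAt (fun x : ℝ => Real.exp (-x⁻¹)) (Real.exp (-1⁻¹) * -(-1 / 1 ^ 2)) 1 := by
    exact ((hasDerivAt_id (1 : ℝ)).fun_inv one_ne_zero).fun_neg.exp
  simp only [radialBump, norm_zero, ne_eq, OfNat.ofNat_ne_zero, not_false_eq_true, zero_pow,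
    sub_zero]
  rw [h.deriv_eq, h2.deriv]
  have := Real.exp_pos (-1⁻¹)
  norm_num at this ⊢
  exact this

variable [InnerProductSpace ℝ V]

lemma contDiff_bumpPotential {n : ℕ∞} : ContDiff ℝ n (bumpPotential : V → ℝ) :=
  expNegInvGlue.contDiff.comp (contDiff_const.sub (contDiff_norm_sq ℝ))

lemma contDiff_radialBump {n : ℕ∞} : ContDiff ℝ n (radialBump : V → ℝ) :=
  contDiff_const.mul
    (contDiff_deriv_expNegInvGlue.comp (contDiff_const.sub (contDiff_norm_sq ℝ)))

lemma fderiv_bumpPotential (y v : V) :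
    fderiv ℝ (bumpPotential : V → ℝ) y v = -(radialBump y * ⟪y, v⟫_ℝ) := by
  have h1 : HasDerivAt expNegInvGlue (deriv expNegInvGlue (1 - ‖y‖ ^ 2)) (1 - ‖y‖ ^ 2) :=
    (expNegInvGlue.contDiff (n := 1)).differentiable (by simp) |>.differentiableAt.hasDerivAt
  have h2 : HasFDerivAt (fun y : V => 1 - ‖y‖ ^ 2) (-(2 • innerSL ℝ y)) y :=
    (hasStrictFDerivAt_norm_sq y).hasFDerivAt.const_sub 1
  have h3 := h1.comp_hasFDerivAt y h2
  change HasFDerivAt (bumpPotential : V → ℝ) _ y at h3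
  rw [h3.fderiv]
  simp [radialBump]
  ring

variable [FiniteDimensional ℝ V]

lemma hasCompactSupport_bumpPotential : HasCompactSupport (bumpPotential : V → ℝ) :=
  HasCompactSupport.intro (isCompact_closedBall (0 : V) 1) fun x hx =>
    bumpPotential_eq_zero (by simpa using (not_le.1 (fun h => hx (by simpa using h))).le)

lemma hasCompactSupport_radialBump : HasCompactSupport (radialBump : V → ℝ) :=
  HasCompactSupport.intro (isCompact_closedBall (0 : V) 1) fun x hx =>
    radialBump_eq_zero (by simpa using (not_le.1 (fun h => hx (by simpa using h))).le)

lemma integral_radialBump_pos [MeasurableSpace V] [BorelSpace V] :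
    0 < ∫ y : V, radialBump y :=
  (contDiff_radialBump (n := 0)).continuous.integral_pos_of_hasCompactSupport_nonneg_nonzero
    hasCompactSupport_radialBump radialBump_nonneg radialBump_zero_pos.ne'

end RadialBump

/-! ### The Laplacian as a sum of second directional derivatives -/

section Laplacian

variable {V : Type*} [NormedAddCommGroup V] [InnerProductSpace ℝ V]
  {F : Type*} [NormedAddCommGroup F] [NormedSpace ℝ F]

lemma fderiv_fderiv_apply {f : V → F} {x : V} (hf : ContDiffAt ℝ 2 f x) (a b : V) :
    fderiv ℝ (fun y => fderiv ℝ f y a) x b = fderiv ℝ (fderiv ℝ f) x b a := by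
  have h : DifferentiableAt ℝ (fderiv ℝ f) x :=
    (hf.fderiv_right (m := 1) (by norm_num)).differentiableAt (by simp)
  rw [fderiv_clm_apply h (differentiableAt_const a)]
  simp

lemma fderiv_fderiv_apply_comm {f : V → F} {x : V} (hf : ContDiffAt ℝ 2 f x) (a b : V) :
    fderiv ℝ (fun y => fderiv ℝ f y a) x b = fderiv ℝ (fun y => fderiv ℝ f y b) x a := by
  rw [fderiv_fderiv_apply hf, fderiv_fderiv_apply hf]
  exact (hf.isSymmSndFDerivAt (by simp)).eq b a

variable [FiniteDimensional ℝ V]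

lemma laplacian_eq_sum_fderiv {ι : Type*} [Fintype ι] (b : OrthonormalBasis ι ℝ V)
    {f : V → F} {x : V} (hf : ContDiffAt ℝ 2 f x) :
    Laplacian.laplacian f x =
      ∑ i, fderiv ℝ (fun y => fderiv ℝ f y (b i)) x (b i) := by
  rw [InnerProductSpace.laplacian_eq_iteratedFDeriv_orthonormalBasis f b]
  refine Finset.sum_congr rfl fun i _ => ?_
  rw [iteratedFDeriv_two_apply, fderiv_fderiv_apply hf]
  simp

end Laplacian

/-! ### The mean value property -/

section MeanValue

variable {V : Type*} [NormedAddCommGroup V] [InnerProductSpace ℝ V] [FiniteDimensional ℝ V]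
  [MeasurableSpace V] [BorelSpace V]
  {F : Type*} [NormedAddCommGroup F] [NormedSpace ℝ F]

/-- The integral is the t-derivative of the bump average of w at scale t. Integration by parts
against `bumpPotential` turns it into t times the integral of the potential against the Laplacian at
x + t y, and only ‖y‖ < 1 contributes. -/
lemma integral_radialBump_smul_fderiv_eq_zero {w : V → F} (hw : ContDiff ℝ 2 w) {x : V} {t : ℝ}
    (hΔ : ∀ z, ‖z - x‖ < |t| → Laplacian.laplacian w z = 0) :
    ∫ y : V, radialBump y • fderiv ℝ w (x + t • y) y = 0 := by
  set b := stdOrthonormalBasis ℝ V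
  set g : _ → V → F := fun i y => fderiv ℝ w (x + t • y) (b i) with hg
  have hDw : ∀ i, ContDiff ℝ 1 (fun z => fderiv ℝ w z (b i)) := fun i =>
    (hw.fderiv_right (m := 1) (by norm_num)).clm_apply contDiff_const
  have hgC : ∀ i, ContDiff ℝ 1 (g i) := fun i =>
    (hDw i).comp (contDiff_const.add (contDiff_id.const_smul t))
  have hgd : ∀ i y, fderiv ℝ (g i) y (b i)
      = t • fderiv ℝ (fun z => fderiv ℝ w z (b i)) (x + t • y) (b i) := by
    intro i y
    have h1 : HasFDerivAt (fun y : V => x + t • y) (t • ContinuousLinearMap.id ℝ V) y :=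
      ((hasFDerivAt_id y).const_smul t).const_add x
    have h2 := ((hDw i).differentiable (by simp) (x + t • y)).hasFDerivAt.comp y h1
    rw [show g i = (fun z => fderiv ℝ w z (b i)) ∘ fun y : V => x + t • y from rfl, h2.fderiv]
    simp
  have hΨ : ContDiff ℝ 1 (bumpPotential : V → ℝ) := contDiff_bumpPotential (n := 1)
  have hΨd : ∀ i, Continuous fun y : V => fderiv ℝ (bumpPotential : V → ℝ) y (b i) := fun i =>
    (hΨ.continuous_fderiv (by simp)).clm_apply continuous_const
  have hI1 : ∀ i, Integrable fun y : V => fderiv ℝ (bumpPotential : V → ℝ) y (b i) • g i y :=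
    fun i => ((hΨd i).smul (hgC i).continuous).integrable_of_hasCompactSupport
      (HasCompactSupport.smul_right
        (hasCompactSupport_bumpPotential.fderiv_apply (𝕜 := ℝ) (b i)))
  have hI2 : ∀ i, Integrable fun y : V => (bumpPotential : V → ℝ) y • fderiv ℝ (g i) y (b i) :=
    fun i => (hΨ.continuous.smul (((hgC i).continuous_fderiv (by simp)).clm_apply
      continuous_const)).integrable_of_hasCompactSupport
      (HasCompactSupport.smul_right hasCompactSupport_bumpPotential)
  have hI3 : ∀ i, Integrable fun y : V => (bumpPotential : V → ℝ) y • g i y :=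
    fun i => (hΨ.continuous.smul (hgC i).continuous).integrable_of_hasCompactSupport
      (HasCompactSupport.smul_right hasCompactSupport_bumpPotential)
  have key : ∀ y : V, radialBump y • fderiv ℝ w (x + t • y) y
      = -∑ i, fderiv ℝ (bumpPotential : V → ℝ) y (b i) • g i y := by
    intro y
    rw [show fderiv ℝ w (x + t • y) y = fderiv ℝ w (x + t • y) (∑ i, ⟪b i, y⟫_ℝ • b i) by
      rw [b.sum_repr' y], map_sum, Finset.smul_sum, ← Finset.sum_neg_distrib]
    refine Finset.sum_congr rfl fun i _ => ?_
    rw [map_smul, fderiv_bumpPotential, neg_smul, neg_neg, smul_smul, real_inner_comm]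
  simp_rw [key]
  rw [integral_neg, integral_finsetSum _ fun i _ => hI1 i, ← Finset.sum_neg_distrib]
  have parts : ∀ i, -∫ y : V, fderiv ℝ (bumpPotential : V → ℝ) y (b i) • g i y
      = ∫ y : V, (bumpPotential : V → ℝ) y • fderiv ℝ (g i) y (b i) := fun i =>
    (integral_smul_fderiv_eq_neg_fderiv_smul_of_integrable (hI1 i) (hI2 i) (hI3 i)
      (fun y _ => hΨ.differentiable (by simp) y)
      (fun y _ => (hgC i).differentiable (by simp) y)).symm
  simp_rw [parts]
  rw [← integral_finsetSum _ fun i _ => hI2 i]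
  rw [← integral_zero V F]
  congr 1
  ext y
  by_cases hy : 1 ≤ ‖y‖
  · simp [bumpPotential_eq_zero hy]
  simp_rw [hgd, ← Finset.smul_sum]
  -- For t = 0 the hypothesis on the Laplacian is empty, but the factor t already kills the
  -- integrand.
  rcases eq_or_ne t 0 with rfl | ht
  · simp
  rw [← laplacian_eq_sum_fderiv b hw.contDiffAt, hΔ, smul_zero, smul_zero]
  simp only [add_sub_cancel_left, norm_smul, Real.norm_eq_abs]
  exact mul_lt_of_lt_one_right (abs_pos.2 ht) (not_le.1 hy)

/-- The mean value property against a radial bump. -/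
lemma integral_radialBump_smul_eq {w : V → F} [CompleteSpace F] (hw : ContDiff ℝ 2 w)
    (hwc : HasCompactSupport w) {x : V} {R : ℝ}
    (hΔ : ∀ z ∈ ball x R, Laplacian.laplacian w z = 0) {r : ℝ} (hr : |r| ≤ R) :
    ∫ y : V, radialBump y • w (x + r • y) = (∫ y : V, radialBump y) • w x := by
  obtain ⟨K, hK⟩ := (hwc.fderiv (𝕜 := ℝ)).exists_bound_of_continuous
    (hw.continuous_fderiv (by simp))
  have hφ : Continuous (radialBump : V → ℝ) := (contDiff_radialBump (n := 0)).continuous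
  have hφc : HasCompactSupport (radialBump : V → ℝ) := hasCompactSupport_radialBump
  have hint : ∀ t : ℝ, Integrable fun y : V => radialBump y • w (x + t • y) := fun t =>
    (hφ.smul (hw.continuous.comp (by fun_prop))).integrable_of_hasCompactSupport
      (HasCompactSupport.smul_right hφc)
  have hcont' : ∀ t : ℝ, Continuous fun y : V => radialBump y • fderiv ℝ w (x + t • y) y :=
    fun t => hφ.smul (((hw.continuous_fderiv (by simp)).comp (by fun_prop)).clm_apply
      continuous_id)
  have hder : ∀ t : ℝ, HasDerivAt (fun t => ∫ y : V, radialBump y • w (x + t • y))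
      (∫ y : V, radialBump y • fderiv ℝ w (x + t • y) y) t := by
    intro t
    refine (hasDerivAt_integral_of_dominated_loc_of_deriv_le (𝕜 := ℝ)
      (F' := fun t (y : V) => radialBump y • fderiv ℝ w (x + t • y) y)
      (bound := fun y : V => radialBump y * K) (s := univ) univ_mem
      (Eventually.of_forall fun t => (hint t).aestronglyMeasurable) (hint t)
      (hcont' t).aestronglyMeasurable ?_ ?_ ?_).2
    · refine Eventually.of_forall fun y t _ => ?_
      rw [norm_smul, Real.norm_of_nonneg (radialBump_nonneg y)]
      by_cases hy : 1 ≤ ‖y‖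
      · simp [radialBump_eq_zero hy]
      · refine mul_le_mul_of_nonneg_left ?_ (radialBump_nonneg y)
        refine ((fderiv ℝ w (x + t • y)).le_opNorm y).trans ?_
        exact (mul_le_of_le_one_right (norm_nonneg _) (not_le.1 hy).le).trans (hK _)
    · exact (hφ.mul continuous_const).integrable_of_hasCompactSupport hφc.mul_right
    · refine Eventually.of_forall fun y t _ => ?_
      have h1 : HasDerivAt (fun t : ℝ => x + t • y) y t := by
        simpa using ((hasDerivAt_id t).smul_const y).const_add x
      exact ((hw.differentiable (by simp) _).hasFDerivAt.comp_hasDerivAt t h1).const_smul _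
  -- The average is constant in t on [-R, R], so its value at r equals that at 0. Negative scales
  -- are included to match the sign in a convolution.
  have hzero : ∀ t ∈ closedBall (0 : ℝ) R, HasDerivWithinAt
      (fun t => ∫ y : V, radialBump y • w (x + t • y)) 0 (closedBall 0 R) t := by
    intro t ht
    rw [← integral_radialBump_smul_fderiv_eq_zero hw (x := x) (t := t) fun z hz => hΔ z (by
      rw [mem_ball, dist_eq_norm]; exact hz.trans_le (by simpa using ht))]
    exact (hder t).hasDerivWithinAt
  have hR : 0 ≤ R := (abs_nonneg r).trans hr
  have := (convex_closedBall (0 : ℝ) R).norm_image_sub_le_of_norm_hasDerivWithin_le (C := 0)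
    hzero (fun t _ => by simp) (x := 0) (y := r) (by simpa using hR) (by simpa using hr)
  rw [zero_mul, norm_le_zero_iff, sub_eq_zero] at this
  rw [this]
  simp [integral_smul_const]

end MeanValue

/-! ### Smoothness and the interior gradient estimate -/

section Regularity

variable {V : Type*} [NormedAddCommGroup V] [InnerProductSpace ℝ V] [FiniteDimensional ℝ V]
  {F : Type*} [NormedAddCommGroup F] [NormedSpace ℝ F]

/-- A cutoff makes the mean value property, stated for global compactly supported functions,
available for local ones. -/
lemma exists_contDiff_hasCompactSupport_eqOn_ball {n : ℕ∞} {f : V → F} {a : V} {r R : ℝ}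
    (hf : ContDiffOn ℝ n f (ball a R)) (hr : 0 < r) (hrR : r < R) :
    ∃ w : V → F, ContDiff ℝ n w ∧ HasCompactSupport w ∧ EqOn w f (ball a r) := by
  let χ : ContDiffBump a := ⟨r, (r + R) / 2, hr, by linarith⟩
  refine ⟨fun x => χ x • f x, contDiff_iff_contDiffAt.2 fun x => ?_,
    χ.hasCompactSupport.smul_right, fun x hx => ?_⟩
  · by_cases hx : x ∈ ball a R
    · exact χ.contDiff.contDiffAt.smul (hf.contDiffAt (isOpen_ball.mem_nhds hx))
    · have hx' : x ∉ tsupport χ := by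
        rw [χ.tsupport_eq, mem_closedBall]
        rw [mem_ball, not_lt] at hx
        change ¬ dist x a ≤ (r + R) / 2
        linarith
      have h0 : (fun x => χ x • f x) =ᶠ[𝓝 x] fun _ => 0 := by
        filter_upwards [notMem_tsupport_iff_eventuallyEq.1 hx'] with y hy
        simp [hy]
      exact contDiffAt_const.congr_of_eventuallyEq h0
  · simp [χ.one_of_mem_closedBall (ball_subset_closedBall hx)]

/-- Up to a constant this is the convolution of w with a rescaled bump, and all derivatives can fall
on the bump. -/
lemma contDiff_integral_radialBump_smul [MeasurableSpace V] [BorelSpace V] {n : ℕ∞}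
    {w : V → F} (hw : Continuous w) {r : ℝ} (hr : r ≠ 0) :
    ContDiff ℝ n fun x => ∫ y : V, radialBump y • w (x + -r • y) := by
  set κ : V → ℝ := fun z => radialBump (r⁻¹ • z) with hκ
  have hκc : HasCompactSupport κ :=
    hasCompactSupport_radialBump.comp_homeomorph (Homeomorph.smulOfNeZero r⁻¹ (inv_ne_zero hr))
  have hκs : ContDiff ℝ n κ := contDiff_radialBump.comp (contDiff_id.const_smul r⁻¹)
  have h := (hκc.contDiff_convolution_left (ContinuousLinearMap.lsmul ℝ ℝ) hκs
    (hw.locallyIntegrable (μ := volume))).const_smul |(r ^ Module.finrank ℝ V)⁻¹|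
  convert h using 1
  ext x
  rw [MeasureTheory.convolution_def, ← Measure.integral_comp_smul]
  refine integral_congr_ae (Eventually.of_forall fun y => ?_)
  simp [hκ, smul_smul, inv_mul_cancel₀ hr, sub_eq_add_neg]

/-- Integrating a directional derivative against the radial bump is controlled by the sup norm. -/
lemma norm_integral_radialBump_smul_fderiv_le [MeasurableSpace V] [BorelSpace V] {h : V → F}
    (hh : ContDiff ℝ 1 h) {M : ℝ} (hM : ∀ y, ‖y‖ ≤ 1 → ‖h y‖ ≤ M) (v : V) :
    ‖∫ y : V, radialBump y • fderiv ℝ h y v‖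
      ≤ (∫ y : V, ‖fderiv ℝ (radialBump : V → ℝ) y‖) * (‖v‖ * M) := by
  have hφ : ContDiff ℝ 1 (radialBump : V → ℝ) := contDiff_radialBump (n := 1)
  have hφd : Continuous fun y : V => fderiv ℝ (radialBump : V → ℝ) y v :=
    (hφ.continuous_fderiv (by simp)).clm_apply continuous_const
  have hI1 : Integrable fun y : V => fderiv ℝ (radialBump : V → ℝ) y v • h y :=
    (hφd.smul hh.continuous).integrable_of_hasCompactSupport
      (HasCompactSupport.smul_right (hasCompactSupport_radialBump.fderiv_apply (𝕜 := ℝ) v))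
  have hI2 : Integrable fun y : V => (radialBump : V → ℝ) y • fderiv ℝ h y v :=
    (hφ.continuous.smul ((hh.continuous_fderiv (by simp)).clm_apply
      continuous_const)).integrable_of_hasCompactSupport
      (HasCompactSupport.smul_right hasCompactSupport_radialBump)
  have hI3 : Integrable fun y : V => (radialBump : V → ℝ) y • h y :=
    (hφ.continuous.smul hh.continuous).integrable_of_hasCompactSupport
      (HasCompactSupport.smul_right hasCompactSupport_radialBump)
  have hparts : ∫ y : V, radialBump y • fderiv ℝ h y v
      = -∫ y : V, fderiv ℝ (radialBump : V → ℝ) y v • h y :=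
    integral_smul_fderiv_eq_neg_fderiv_smul_of_integrable hI1 hI2 hI3
      (fun y _ => hφ.differentiable (by simp) y) (fun y _ => hh.differentiable (by simp) y)
  rw [hparts, norm_neg, ← integral_mul_const]
  have hD : Continuous (fderiv ℝ (radialBump : V → ℝ)) := hφ.continuous_fderiv (by simp)
  have hDc : HasCompactSupport (fderiv ℝ (radialBump : V → ℝ)) :=
    hasCompactSupport_radialBump.fderiv (𝕜 := ℝ)
  have hnorm : Integrable fun y : V => ‖fderiv ℝ (radialBump : V → ℝ) y‖ :=
    hD.norm.integrable_of_hasCompactSupport hDc.norm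
  have hint : Integrable fun y : V => ‖fderiv ℝ (radialBump : V → ℝ) y‖ * (‖v‖ * M) :=
    hnorm.mul_const _
  refine norm_integral_le_of_norm_le hint (Eventually.of_forall fun y => ?_)
  rw [norm_smul]
  by_cases hy : 1 < ‖y‖
  · have h0 : (radialBump : V → ℝ) =ᶠ[𝓝 y] fun _ => 0 := by
      filter_upwards [(isOpen_lt continuous_const continuous_norm).mem_nhds hy] with z hz
      exact radialBump_eq_zero (le_of_lt hz)
    rw [h0.fderiv_eq]
    simp
  · rw [← mul_assoc]
    exact mul_le_mul (ContinuousLinearMap.le_opNorm _ _) (hM y (not_lt.1 hy)) (norm_nonneg _)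
      (by positivity)

namespace InnerProductSpace

lemma HarmonicAt.exists_ball {f : V → F} {x : V} (hf : HarmonicAt f x) :
    ∃ R > 0, HarmonicOnNhd f (ball x R) := by
  obtain ⟨R, hR, h⟩ := Metric.eventually_nhds_iff_ball.1 hf.eventually
  exact ⟨R, hR, h⟩

lemma HarmonicOnNhd.laplacian_eq_zero {f : V → F} {s : Set V} (hf : HarmonicOnNhd f s) {x : V}
    (hx : x ∈ s) : Laplacian.laplacian f x = 0 := (hf x hx).2.self_of_nhds

/-- Harmonic functions are smooth. -/
lemma HarmonicAt.contDiffAt_enat [CompleteSpace F] {f : V → F} {x : V} (hf : HarmonicAt f x)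
    {n : ℕ∞} : ContDiffAt ℝ n f x := by
  let _ : MeasurableSpace V := borel V
  have : BorelSpace V := ⟨rfl⟩
  obtain ⟨R, hR, h⟩ := hf.exists_ball
  obtain ⟨w, hw, hwc, hwf⟩ := exists_contDiff_hasCompactSupport_eqOn_ball (n := 2)
    h.contDiffOn (half_pos hR) (half_lt_self hR)
  have hΔ : ∀ z ∈ ball x (R / 2), Laplacian.laplacian w z = 0 := fun z hz => by
    have : w =ᶠ[𝓝 z] f := hwf.eventuallyEq_of_mem (isOpen_ball.mem_nhds hz)
    rw [(laplacian_congr_nhds this).self_of_nhds]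
    exact h.laplacian_eq_zero (ball_subset_ball (by linarith) hz)
  have hc := (integral_radialBump_pos (V := V)).ne'
  -- Near x, f equals its own normalized bump average. Centre z and scale both stay within R / 4, so
  -- only the ball of radius R / 2, where w = f, is seen.
  have hsm : ContDiff ℝ n fun z : V =>
      (∫ y : V, radialBump y)⁻¹ • ∫ y : V, radialBump y • w (z + -(R / 4) • y) :=
    (contDiff_integral_radialBump_smul hw.continuous (by positivity)).const_smul _
  refine hsm.contDiffAt.congr_of_eventuallyEq ?_
  filter_upwards [ball_mem_nhds x (show 0 < R / 4 by positivity)] with z hz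
  rw [integral_radialBump_smul_eq hw hwc (x := z) (R := R / 4) _
    (by rw [abs_neg, abs_of_pos]; positivity), smul_smul, inv_mul_cancel₀ hc, one_smul]
  · exact (hwf (ball_subset_ball (by linarith) hz)).symm
  · intro y hy
    refine hΔ y ?_
    rw [mem_ball] at *
    linarith [dist_triangle y z x]

/-- Directional derivatives of harmonic functions are harmonic. -/
lemma HarmonicAt.fderiv_apply [CompleteSpace F] {f : V → F} {x : V} (hf : HarmonicAt f x)
    (v : V) : HarmonicAt (fun y => fderiv ℝ f y v) x := by
  have hD : ∀ {g : V → F} {y : V} (m : ℕ) (a : V), ContDiffAt ℝ ((m + 1 : ℕ) : ℕ∞) g y →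
      ContDiffAt ℝ (m : ℕ∞) (fun z => fderiv ℝ g z a) y := fun m a hg =>
    (hg.fderiv_right (m := (m : ℕ∞)) (by norm_cast)).clm_apply contDiffAt_const
  refine ⟨hD 2 v hf.contDiffAt_enat, ?_⟩
  filter_upwards [hf.eventually.eventually_nhds] with y hy
  set b := stdOrthonormalBasis ℝ V
  have hy0 : HarmonicAt f y := hy.self_of_nhds
  rw [laplacian_eq_sum_fderiv b (hD 2 v hy0.contDiffAt_enat)]
  have step : ∀ i, fderiv ℝ (fun z => fderiv ℝ (fun z => fderiv ℝ f z v) z (b i)) y (b i)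
      = fderiv ℝ (fun z => fderiv ℝ (fun z => fderiv ℝ f z (b i)) z (b i)) y v := by
    intro i
    have h1 : (fun z => fderiv ℝ (fun z => fderiv ℝ f z v) z (b i)) =ᶠ[𝓝 y]
        fun z => fderiv ℝ (fun z => fderiv ℝ f z (b i)) z v := by
      filter_upwards [hy] with z hz
      exact fderiv_fderiv_apply_comm hz.1 _ _
    rw [h1.fderiv_eq, fderiv_fderiv_apply_comm (hD 2 (b i) hy0.contDiffAt_enat)]
  simp_rw [step]
  have h2 : (fun z => ∑ i, fderiv ℝ (fun z => fderiv ℝ f z (b i)) z (b i)) =ᶠ[𝓝 y]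
      fun _ => 0 := by
    filter_upwards [hy] with z hz
    rw [← laplacian_eq_sum_fderiv b hz.1]
    exact hz.2.self_of_nhds
  have h3 : fderiv ℝ (fun z => ∑ i, fderiv ℝ (fun z => fderiv ℝ f z (b i)) z (b i)) y
      = ∑ i, fderiv ℝ (fun z => fderiv ℝ (fun z => fderiv ℝ f z (b i)) z (b i)) y :=
    fderiv_fun_sum fun i _ => (hD 1 (b i) (hD 2 (b i) hy0.contDiffAt_enat)).differentiableAt
      (by simp)
  rw [h2.fderiv_eq] at h3
  simpa using (congrArg (fun L : V →L[ℝ] F => L v) h3).symm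

variable (V F) in
/-- The interior gradient estimate for harmonic functions. -/
lemma exists_norm_fderiv_le [CompleteSpace F] : ∃ C : ℝ, 0 < C ∧
    ∀ (f : V → F) (x : V) (R M : ℝ) (v : V), 0 < R → HarmonicOnNhd f (ball x R) →
      (∀ z ∈ ball x R, ‖f z‖ ≤ M) → ‖fderiv ℝ f x v‖ ≤ C / R * M * ‖v‖ := by
  let _ : MeasurableSpace V := borel V
  have : BorelSpace V := ⟨rfl⟩
  have hc := integral_radialBump_pos (V := V)
  set c := ∫ y : V, radialBump y with hcdef
  set L := ∫ y : V, ‖fderiv ℝ (radialBump : V → ℝ) y‖ with hL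
  have hL0 : 0 ≤ L := integral_nonneg fun _ => norm_nonneg _
  -- The 4 comes from averaging at scale R / 4; L + 1 replaces L only to make the constant visibly
  -- positive.
  refine ⟨4 * (L + 1) / c, by positivity, fun f x R M v hR hf hM => ?_⟩
  have hM0 : 0 ≤ M := (norm_nonneg _).trans (hM x (mem_ball_self hR))
  obtain ⟨w, hw, hwc, hwf⟩ := exists_contDiff_hasCompactSupport_eqOn_ball (n := 3) (f := f)
    (fun z hz => (hf z hz).contDiffAt_enat.contDiffWithinAt) (half_pos hR) (half_lt_self hR)
  have hwe : ∀ z ∈ ball x (R / 2), w =ᶠ[𝓝 z] f := fun z hz =>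
    hwf.eventuallyEq_of_mem (isOpen_ball.mem_nhds hz)
  set r := R / 4 with hr
  have hr0 : 0 < r := by positivity
  set g : V → F := fun z => fderiv ℝ w z v with hg
  have hgC : ContDiff ℝ 2 g := (hw.fderiv_right (m := 2) (by norm_cast)).clm_apply contDiff_const
  have hgc : HasCompactSupport g := hwc.fderiv_apply (𝕜 := ℝ) v
  have hΔ : ∀ z ∈ ball x (R / 2), Laplacian.laplacian g z = 0 := fun z hz => by
    have : g =ᶠ[𝓝 z] fun y => fderiv ℝ f y v := by
      filter_upwards [(hwe z hz).eventually_nhds] with y hy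
      simp only [hg]
      rw [Filter.EventuallyEq.fderiv_eq hy]
    rw [(laplacian_congr_nhds this).self_of_nhds]
    exact ((hf z (ball_subset_ball (by linarith) hz)).fderiv_apply v).2.self_of_nhds
  have hmv := integral_radialBump_smul_eq hgC hgc (x := x) hΔ (r := r)
    (by rw [abs_of_pos hr0]; linarith)
  set h : V → F := fun y => w (x + r • y) with hh
  have hhC : ContDiff ℝ 1 h := (hw.of_le (by norm_cast)).comp
    (contDiff_const.add (contDiff_id.const_smul r))
  have hhd : ∀ y, fderiv ℝ h y v = r • g (x + r • y) := by
    intro y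
    have h1 : HasFDerivAt (fun y : V => x + r • y) (r • ContinuousLinearMap.id ℝ V) y :=
      ((hasFDerivAt_id y).const_smul r).const_add x
    have h2 := (hw.differentiable (by simp) (x + r • y)).hasFDerivAt.comp y h1
    rw [show h = w ∘ fun y : V => x + r • y from rfl, h2.fderiv]
    simp [hg]
  have hbound := norm_integral_radialBump_smul_fderiv_le hhC (M := M) (fun y hy => ?_) v
  -- The mean value property applies to the harmonic derivative g; the chain rule then writes r g(x
  -- + r y) as a derivative of the rescaled h, ready for integration by parts.
  · have heq : (r * c) • fderiv ℝ f x v = ∫ y : V, radialBump y • fderiv ℝ h y v := by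
      rw [mul_smul, ← (hwe x (mem_ball_self (half_pos hR))).fderiv_eq]
      change r • c • g x = _
      rw [← hmv, ← integral_smul]
      refine integral_congr_ae (Eventually.of_forall fun y => ?_)
      simp only [hhd]
      rw [smul_comm]
    rw [← heq, norm_smul, Real.norm_of_nonneg (by positivity), ← hL] at hbound
    have hrw : 4 * (L + 1) / c / R * M * ‖v‖ = (L + 1) * (‖v‖ * M) / (r * c) := by
      rw [hr]
      field_simp
    rw [hrw, le_div_iff₀ (by positivity)]
    have : 0 ≤ ‖v‖ * M := by positivity
    linarith
  · have hz : x + r • y ∈ ball x (R / 2) := by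
      rw [mem_ball, dist_eq_norm, add_sub_cancel_left, norm_smul, Real.norm_of_nonneg hr0.le]
      nlinarith
    simp only [hh]
    rw [hwf hz]
    exact hM _ (ball_subset_ball (by linarith) hz)

end InnerProductSpace

end Regularity

/-! ### Cauchy estimates, unique continuation and the Cauchy problem -/

section Continuation

variable {V : Type*} [NormedAddCommGroup V]
  {F : Type*} [NormedAddCommGroup F] [NormedSpace ℝ F]

/-- The `m`-th derivative in the direction `v`. -/
noncomputable def iteratedDirDeriv [NormedSpace ℝ V] (v : V) (m : ℕ) (f : V → F) : V → F :=
  (fun g x => fderiv ℝ g x v)^[m] f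

section

variable [NormedSpace ℝ V]

lemma iteratedDirDeriv_zero (v : V) (f : V → F) : iteratedDirDeriv v 0 f = f := rfl

lemma iteratedDirDeriv_succ (v : V) (m : ℕ) (f : V → F) :
    iteratedDirDeriv v (m + 1) f = fun x => fderiv ℝ (iteratedDirDeriv v m f) x v :=
  Function.iterate_succ_apply' _ _ _

lemma iteratedDirDeriv_eq_zero_of_eventuallyEq {f : V → F} {a : V} (hf : f =ᶠ[𝓝 a] 0) (v : V)
    (m : ℕ) : iteratedDirDeriv v m f =ᶠ[𝓝 a] 0 := by
  induction m with
  | zero => exact hf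
  | succ m ih =>
    rw [iteratedDirDeriv_succ]
    filter_upwards [ih.eventually_nhds] with y hy
    rw [Filter.EventuallyEq.fderiv_eq hy]
    simp

/-- Taylor's bound along a segment for a function whose derivatives up to order `m - 1` vanish at
the initial point. -/
lemma norm_le_of_iteratedDirDeriv_eq_zero {f : V → F} {a v : V} {T B : ℝ} {m : ℕ}
    (hd : ∀ j < m, ∀ t ∈ Icc 0 T, DifferentiableAt ℝ (iteratedDirDeriv v j f) (a + t • v))
    (h0 : ∀ j < m, iteratedDirDeriv v j f a = 0)
    (hB : ∀ t ∈ Icc 0 T, ‖iteratedDirDeriv v m f (a + t • v)‖ ≤ B) {t : ℝ} (ht : t ∈ Icc 0 T) :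
    ‖f (a + t • v)‖ ≤ B * t ^ m / m.factorial := by
  -- Integrate downwards from the bounded derivative of order m; each integration raises the power
  -- of t by one.
  suffices H : ∀ i ≤ m, ∀ t ∈ Icc 0 T,
      ‖iteratedDirDeriv v (m - i) f (a + t • v)‖ ≤ B * t ^ i / i.factorial by
    simpa [iteratedDirDeriv_zero] using H m le_rfl t ht
  intro i
  induction i with
  | zero => intro _ t ht; simpa using hB t ht
  | succ i ih =>
    intro hi t ht
    set j := m - (i + 1) with hj
    have hj1 : m - i = j + 1 := by omega
    have hjm : j < m := by omega
    have hder : ∀ s ∈ Icc 0 T, HasDerivAt (fun s : ℝ => iteratedDirDeriv v j f (a + s • v))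
        (iteratedDirDeriv v (j + 1) f (a + s • v)) s := by
      intro s hs
      have h1 : HasDerivAt (fun s : ℝ => a + s • v) v s := by
        simpa using ((hasDerivAt_id s).smul_const v).const_add a
      rw [iteratedDirDeriv_succ]
      exact (hd j hjm s hs).hasFDerivAt.comp_hasDerivAt s h1
    refine image_norm_le_of_norm_deriv_right_le_deriv_boundary (a := 0) (b := T)
      (fun s hs => (hder s hs).continuousAt.continuousWithinAt)
      (fun s hs => (hder s (Ico_subset_Icc_self hs)).hasDerivWithinAt)
      (B := fun s => B * s ^ (i + 1) / (i + 1).factorial)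
      (B' := fun s => B * s ^ i / i.factorial) (by simp [h0 j hjm]) (fun s => ?_)
      (fun s hs => ?_) ht
    · have := ((hasDerivAt_pow (i + 1) s).const_mul B).div_const ((i + 1).factorial : ℝ)
      refine this.congr_deriv ?_
      rw [Nat.factorial_succ]
      push_cast
      have : (i.factorial : ℝ) ≠ 0 := by positivity
      field_simp
    · rw [← hj1]
      exact ih (by omega) s (Ico_subset_Icc_self hs)

end

namespace InnerProductSpace

variable [InnerProductSpace ℝ V]

lemma fderiv_apply_eq_zero_of_eqOn_orthogonal {g : V → F} {S : Set V} (hS : IsOpen S) {n b : V}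
    (hb : ⟪b, n⟫_ℝ = 0) (hg : ∀ x ∈ S, ⟪x, n⟫_ℝ = 0 → g x = 0) {x : V} (hx : x ∈ S)
    (hxn : ⟪x, n⟫_ℝ = 0) (hd : DifferentiableAt ℝ g x) : fderiv ℝ g x b = 0 := by
  have h1 : HasDerivAt (fun s : ℝ => x + s • b) b 0 := by
    simpa using ((hasDerivAt_id (0 : ℝ)).smul_const b).const_add x
  have h2 : HasDerivAt (fun s : ℝ => g (x + s • b)) (fderiv ℝ g x b) 0 :=
    HasFDerivAt.comp_hasDerivAt (0 : ℝ) (by simpa using hd.hasFDerivAt) h1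
  have h3 : (fun s : ℝ => g (x + s • b)) =ᶠ[𝓝 0] fun _ => 0 := by
    have hc : ContinuousAt (fun s : ℝ => x + s • b) 0 := h1.continuousAt
    filter_upwards [hc.preimage_mem_nhds (hS.mem_nhds (by simpa using hx))] with s hs
    refine hg _ hs ?_
    rw [inner_add_left, inner_smul_left, hxn, hb]
    simp
  exact h2.unique ((hasDerivAt_const (0 : ℝ) (0 : F)).congr_of_eventuallyEq h3)

variable [FiniteDimensional ℝ V]

lemma HarmonicOnNhd.exists_norm_le_closedBall {f : V → F} {a : V} {R : ℝ}
    (hf : HarmonicOnNhd f (closedBall a R)) : ∃ M, ∀ z ∈ closedBall a R, ‖f z‖ ≤ M :=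
  (isCompact_closedBall a R).exists_bound_of_continuousOn hf.continuousOn

variable [CompleteSpace F]

lemma HarmonicOnNhd.iteratedDirDeriv {f : V → F} {s : Set V} (hf : HarmonicOnNhd f s) (v : V)
    (m : ℕ) : HarmonicOnNhd (iteratedDirDeriv v m f) s := by
  induction m with
  | zero => exact hf
  | succ m ih =>
    rw [iteratedDirDeriv_succ]
    exact fun x hx => (ih x hx).fderiv_apply v

variable (V F) in
/-- Cauchy type estimates for the directional derivatives of a harmonic function. -/
lemma exists_norm_iteratedDirDeriv_le : ∃ C : ℝ, 0 < C ∧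
    ∀ (f : V → F) (a v : V) (R M : ℝ), 0 < R → ‖v‖ = 1 → HarmonicOnNhd f (ball a R) →
      (∀ z ∈ ball a R, ‖f z‖ ≤ M) → ∀ m : ℕ, ∀ x ∈ ball a (R / 2),
        ‖_root_.iteratedDirDeriv v m f x‖ ≤ (C * m / R) ^ m * M := by
  obtain ⟨C, hC, h⟩ := exists_norm_fderiv_le V F
  refine ⟨2 * C, by positivity, fun f a v R M hR hv hf hM m x hx => ?_⟩
  rcases Nat.eq_zero_or_pos m with rfl | hm
  · simpa [iteratedDirDeriv_zero] using hM x (ball_subset_ball (by linarith) hx)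
  have hm' : (0 : ℝ) < m := by exact_mod_cast hm
  -- The margin R / 2 is split into m equal shrinkings of the ball, one per derivative, each costing
  -- a factor C / s = 2 C m / R.
  set s := R / 2 / m with hs
  have hs0 : 0 < s := by positivity
  have key : ∀ j : ℕ, j ≤ m → ∀ x ∈ ball a (R - j * s),
      ‖_root_.iteratedDirDeriv v j f x‖ ≤ (C / s) ^ j * M := by
    intro j
    induction j with
    | zero => intro _ x hx; simpa [iteratedDirDeriv_zero] using hM x (by simpa using hx)
    | succ j ih =>
      intro hj x hx
      have hsub : ball x s ⊆ ball a (R - j * s) := by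
        intro z hz
        rw [mem_ball] at *
        push_cast at hx
        linarith [dist_triangle z x a]
      have hharm : HarmonicOnNhd (_root_.iteratedDirDeriv v j f) (ball x s) :=
        (hf.iteratedDirDeriv v j).mono (hsub.trans (ball_subset_ball (by
          have : 0 ≤ j * s := by positivity
          linarith)))
      rw [iteratedDirDeriv_succ]
      refine (h _ x s _ v hs0 hharm fun z hz => ih (by omega) z (hsub hz)).trans_eq ?_
      rw [hv]
      ring
  have hms : m * s = R / 2 := by rw [hs]; field_simp
  have := key m le_rfl x (by rw [hms]; convert hx using 2; ring)
  convert this using 3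
  rw [hs]
  field_simp

variable (V F) in
/-- If all directional derivatives of a bounded harmonic function on a ball vanish at the centre,
then it vanishes along the corresponding ray on a segment of length comparable to the radius. -/
lemma exists_ray_eq_zero : ∃ κ : ℝ, 0 < κ ∧ κ ≤ 1 / 4 ∧
    ∀ (f : V → F) (a v : V) (R M : ℝ), 0 < R → ‖v‖ = 1 → HarmonicOnNhd f (ball a R) →
      (∀ z ∈ ball a R, ‖f z‖ ≤ M) → (∀ m, _root_.iteratedDirDeriv v m f a = 0) →
      ∀ t : ℝ, 0 ≤ t → t < κ * R → f (a + t • v) = 0 := by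
  obtain ⟨C, hC, h⟩ := exists_norm_iteratedDirDeriv_le V F
  have he := Real.exp_pos 1
  -- The bound 1 / 4 keeps the segment in the half ball; the bound 1 / (C e) makes the ratio q below
  -- smaller than 1.
  refine ⟨min (1 / 4) (1 / (C * Real.exp 1)), by positivity, min_le_left _ _,
    fun f a v R M hR hv hf hM h0 t ht htR => ?_⟩
  have hM0 : 0 ≤ M := (norm_nonneg _).trans (hM a (mem_ball_self hR))
  have ht1 : t < R / 2 := by
    have : min (1 / 4) (1 / (C * Real.exp 1)) * R ≤ 1 / 4 * R :=
      mul_le_mul_of_nonneg_right (min_le_left _ _) hR.le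
    linarith
  have ht2 : t < 1 / (C * Real.exp 1) * R :=
    htR.trans_le (mul_le_mul_of_nonneg_right (min_le_right _ _) hR.le)
  set q := C * Real.exp 1 * t / R with hq
  have hq0 : 0 ≤ q := by positivity
  have hq1 : q < 1 := by
    rw [hq, div_lt_one hR]
    calc C * Real.exp 1 * t < C * Real.exp 1 * (1 / (C * Real.exp 1) * R) := by gcongr
      _ = R := by field_simp
  have hmem : ∀ s ∈ Icc 0 t, a + s • v ∈ ball a (R / 2) := by
    intro s hs
    rw [mem_ball, dist_eq_norm, add_sub_cancel_left, norm_smul, hv, mul_one,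
      Real.norm_of_nonneg hs.1]
    exact hs.2.trans_lt ht1
  have hbd : ∀ m : ℕ, ‖f (a + t • v)‖ ≤ M * q ^ m := by
    intro m
    refine (norm_le_of_iteratedDirDeriv_eq_zero (T := t) (m := m) (fun j _ s hs => ?_)
      (fun j _ => h0 j) (fun s hs => h f a v R M hR hv hf hM m _ (hmem s hs))
      ⟨ht, le_rfl⟩).trans ?_
    · exact ((hf.iteratedDirDeriv v j) _ (ball_subset_ball (by linarith)
        (hmem s hs))).1.differentiableAt (by simp)
    · have hexp := Real.pow_div_factorial_le_exp m (Nat.cast_nonneg m) m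
      have hem : Real.exp m = Real.exp 1 ^ m := by rw [← Real.exp_nat_mul, mul_one]
      calc (C * m / R) ^ m * M * t ^ m / m.factorial
          = M * (C * t / R) ^ m * ((m : ℝ) ^ m / m.factorial) := by
            simp only [div_pow, mul_pow]; ring
        _ ≤ M * (C * t / R) ^ m * Real.exp m := by gcongr
        _ = M * q ^ m := by rw [hem, mul_assoc, ← mul_pow, hq]; congr 2; ring
  have hlim : Tendsto (fun m : ℕ => M * q ^ m) atTop (𝓝 0) := by
    simpa using (tendsto_pow_atTop_nhds_zero_of_lt_one hq0 hq1).const_mul M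
  exact norm_le_zero_iff.1 (ge_of_tendsto' hlim hbd)

/-- Unique continuation for harmonic functions. -/
theorem HarmonicOnNhd.eqOn_zero_of_preconnected {f : V → F} {Ω : Set V}
    (hf : HarmonicOnNhd f Ω) (hΩ : IsOpen Ω) (hc : IsPreconnected Ω) {x₀ : V} (hx₀ : x₀ ∈ Ω)
    (h0 : f =ᶠ[𝓝 x₀] 0) : ∀ x ∈ Ω, f x = 0 := by
  obtain ⟨κ, hκ, hκ4, hray⟩ := exists_ray_eq_zero V F
  -- The interior of the zero set is relatively closed: κ does not depend on the centre, so a point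
  -- a of it close enough to a limit point x has a zero ball that contains x.
  have hsub : Ω ⊆ {x | f =ᶠ[𝓝 x] 0} := by
    refine hc.subset_of_closure_inter_subset isOpen_setOfPred_eventually_nhds ⟨x₀, hx₀, h0⟩ ?_
    rintro x ⟨hx, hxΩ⟩
    obtain ⟨R, hR, hRΩ⟩ := nhds_basis_closedBall.mem_iff.1 (hΩ.mem_nhds hxΩ)
    obtain ⟨M, hM⟩ := HarmonicOnNhd.exists_norm_le_closedBall (hf.mono hRΩ)
    obtain ⟨a, ha, hxa⟩ := Metric.mem_closure_iff.1 hx (κ * (R / 2)) (by positivity)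
    have hball : ball a (R / 2) ⊆ closedBall x R := by
      intro z hz
      rw [mem_ball] at hz
      rw [mem_closedBall]
      rw [dist_comm] at hxa
      nlinarith [dist_triangle z a x]
    have hzero : ∀ y ∈ ball a (κ * (R / 2)), f y = 0 := by
      intro y hy
      rcases eq_or_ne y a with rfl | hya
      · exact Filter.EventuallyEq.eq_of_nhds ha
      have hn : 0 < ‖y - a‖ := norm_pos_iff.2 (sub_ne_zero.2 hya)
      have := hray f a (‖y - a‖⁻¹ • (y - a)) (R / 2) M (half_pos hR)
        (by rw [norm_smul, norm_inv, norm_norm, inv_mul_cancel₀ hn.ne'])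
        (hf.mono (hball.trans hRΩ)) (fun z hz => hM z (hball hz))
        (fun m => (iteratedDirDeriv_eq_zero_of_eventuallyEq ha _ m).eq_of_nhds)
        ‖y - a‖ hn.le (by rwa [mem_ball, dist_eq_norm] at hy)
      rwa [smul_smul, mul_inv_cancel₀ hn.ne', one_smul, add_sub_cancel] at this
    exact eventually_of_mem (isOpen_ball.mem_nhds hxa) hzero
  exact fun x hx => Filter.EventuallyEq.eq_of_nhds (hsub hx)

/-- On a hyperplane on which a harmonic function vanishes, its second normal derivative
vanishes. -/
lemma HarmonicOnNhd.fderiv_fderiv_normal_eq_zero {g : V → F} {S : Set V} (hS : IsOpen S) {n : V}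
    (hn : ‖n‖ = 1) (hh : HarmonicOnNhd g S) (hg : ∀ x ∈ S, ⟪x, n⟫_ℝ = 0 → g x = 0) {x : V}
    (hx : x ∈ S) (hxn : ⟪x, n⟫_ℝ = 0) :
    fderiv ℝ (fun y => fderiv ℝ g y n) x n = 0 := by
  -- Complete n to an orthonormal basis. The other basis vectors are tangential, so their second
  -- derivatives vanish and the Laplacian reduces to the normal term.
  have ho : Orthonormal ℝ ((↑) : ({n} : Set V) → V) := by
    refine ⟨fun ⟨i, hi⟩ => ?_, fun ⟨i, hi⟩ ⟨j, hj⟩ hij => ?_⟩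
    · rw [mem_singleton_iff] at hi
      simpa [hi] using hn
    · rw [mem_singleton_iff] at hi hj
      simp [hi, hj] at hij
  obtain ⟨u, b, hu, hb⟩ := ho.exists_orthonormalBasis_extension
  have hl := laplacian_eq_sum_fderiv b (hh x hx).1
  rw [hh.laplacian_eq_zero hx] at hl
  have hnu : n ∈ u := by simpa using hu
  rw [Finset.sum_eq_single_of_mem (⟨n, hnu⟩ : u) (Finset.mem_univ _)] at hl
  · rw [hb] at hl
    exact hl.symm
  · intro i _ hi
    have hbi : ⟪b i, n⟫_ℝ = 0 := by
      have := b.orthonormal.inner_eq_zero hi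
      rwa [hb] at this ⊢
    refine fderiv_apply_eq_zero_of_eqOn_orthogonal hS hbi (fun y hy hyn => ?_) hx hxn ?_
    · exact fderiv_apply_eq_zero_of_eqOn_orthogonal hS hbi hg hy hyn
        ((hh y hy).1.differentiableAt (by simp))
    · exact ((hh x hx).fderiv_apply (b i)).1.differentiableAt (by simp)

/-- Uniqueness for the Cauchy problem with data on a hyperplane. -/
lemma HarmonicOnNhd.eventuallyEq_zero_of_cauchy_data {f : V → F} {R : ℝ} (hR : 0 < R) {n : V}
    (hn : ‖n‖ = 1) (hf : HarmonicOnNhd f (ball 0 R))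
    (h0 : ∀ x ∈ ball (0 : V) R, ⟪x, n⟫_ℝ = 0 → f x = 0)
    (h1 : ∀ x ∈ ball (0 : V) R, ⟪x, n⟫_ℝ = 0 → fderiv ℝ f x n = 0) : f =ᶠ[𝓝 0] 0 := by
  obtain ⟨κ, hκ, hκ4, hray⟩ := exists_ray_eq_zero V F
  obtain ⟨M, hM⟩ := HarmonicOnNhd.exists_norm_le_closedBall (a := 0) (R := R / 2)
    (hf.mono (closedBall_subset_ball (half_lt_self hR)))
  -- Used for v = n and v = -n. The Cauchy data start the induction at orders 0 and 1; vanishing of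
  -- order m gives order m + 2 by the preceding lemma.
  have hall : ∀ v : V, ‖v‖ = 1 → (∀ x, ⟪x, v⟫_ℝ = 0 ↔ ⟪x, n⟫_ℝ = 0) →
      (∀ x ∈ ball (0 : V) R, ⟪x, n⟫_ℝ = 0 → fderiv ℝ f x v = 0) →
      ∀ m, ∀ x ∈ ball (0 : V) R, ⟪x, v⟫_ℝ = 0 → _root_.iteratedDirDeriv v m f x = 0 := by
    intro v hv hvn hv1 m
    induction m using Nat.twoStepInduction with
    | zero => exact fun x hx hxv => h0 x hx ((hvn x).1 hxv)
    | one => exact fun x hx hxv => hv1 x hx ((hvn x).1 hxv)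
    | more m ih _ =>
      intro x hx hxv
      rw [iteratedDirDeriv_succ, iteratedDirDeriv_succ]
      exact (hf.iteratedDirDeriv v m).fderiv_fderiv_normal_eq_zero isOpen_ball hv ih hx hxv
  have hside : ∀ v : V, ‖v‖ = 1 → (∀ x, ⟪x, v⟫_ℝ = 0 ↔ ⟪x, n⟫_ℝ = 0) →
      (∀ x ∈ ball (0 : V) R, ⟪x, n⟫_ℝ = 0 → fderiv ℝ f x v = 0) →
      ∀ p : V, ⟪p, n⟫_ℝ = 0 → ‖p‖ < R / 4 → ∀ t : ℝ, 0 ≤ t → t < κ * (R / 4) →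
        f (p + t • v) = 0 := by
    intro v hv hvn hv1 p hp hpR t ht htR
    have hsub : ball p (R / 4) ⊆ closedBall 0 (R / 2) := by
      intro z hz
      rw [mem_ball, dist_eq_norm] at hz
      rw [mem_closedBall, dist_zero_right]
      have := norm_add_le (z - p) p
      rw [sub_add_cancel] at this
      linarith
    exact hray f p v (R / 4) M (by positivity) hv
      (hf.mono (hsub.trans (closedBall_subset_ball (half_lt_self hR))))
      (fun z hz => hM z (hsub hz))
      (fun m => hall v hv hvn hv1 m p (by rw [mem_ball, dist_zero_right]; linarith)
        ((hvn p).2 hp)) t ht htR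
  filter_upwards [ball_mem_nhds (0 : V) (show 0 < κ * (R / 4) / 2 by positivity)] with y hy
  rw [mem_ball, dist_zero_right] at hy
  set t := ⟪y, n⟫_ℝ with ht
  have htn : |t| ≤ ‖y‖ := by simpa [hn] using abs_real_inner_le_norm y n
  have hp : ⟪y - t • n, n⟫_ℝ = 0 := by
    rw [inner_sub_left, inner_smul_left, real_inner_self_eq_norm_sq, hn]
    simp [ht]
  have hpn : ‖y - t • n‖ < R / 4 := by
    have := norm_sub_le y (t • n)
    rw [norm_smul, hn, mul_one, Real.norm_eq_abs] at this
    nlinarith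
  rcases le_total 0 t with h | h
  · have := hside n hn (fun _ => Iff.rfl) h1 _ hp hpn t h (by
      rw [abs_of_nonneg h] at htn
      nlinarith)
    simpa using this
  · have := hside (-n) (by rwa [norm_neg]) (fun x => by rw [inner_neg_right, neg_eq_zero])
      (fun x hx hxn => by rw [map_neg, h1 x hx hxn, neg_zero]) _ hp hpn (-t) (by linarith) (by
      rw [abs_of_nonpos h] at htn
      nlinarith)
    simpa using this

end InnerProductSpace

end Continuation

/-! ### Reflections across hyperplanes and the irrational rotation -/

section Reflection

variable {V : Type*} [NormedAddCommGroup V] [InnerProductSpace ℝ V]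
  {F : Type*} [NormedAddCommGroup F]

lemma reflection_orthogonal_span_singleton_apply {n : V} (hn : ‖n‖ = 1) (x : V) :
    (ℝ ∙ n)ᗮ.reflection x = x - (2 * ⟪x, n⟫_ℝ) • n := by
  rw [Submodule.reflection_orthogonal_apply, Submodule.reflection_singleton_apply, hn,
    real_inner_comm]
  simp [two_mul, add_smul, two_smul]

/-- The zero set contains 0 and is invariant under the subgroup generated by α and β, which is dense
because α / β is irrational. -/
lemma eq_zero_of_irrational_translation {g : ℝ → F} (hg : Continuous g) {α β : ℝ}
    (hαβ : Irrational (α / β)) (h0 : g 0 = 0)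
    (hα : ∀ t, g (t + α) = 0 ↔ g t = 0) (hβ : ∀ t, g (t + β) = 0 ↔ g t = 0) (t : ℝ) :
    g t = 0 := by
  have hmem : ∀ s ∈ AddSubgroup.closure ({α, β} : Set ℝ), ∀ t, g (t + s) = 0 ↔ g t = 0 := by
    intro s hs
    induction hs using AddSubgroup.closure_induction with
    | mem x hx =>
      rcases hx with rfl | rfl
      · exact hα
      · exact hβ
    | zero => simp
    | add x y _ _ hx hy => exact fun t => by rw [← add_assoc, hy, hx]
    | neg x _ hx => exact fun t => by rw [← hx (t + -x), neg_add_cancel_right]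
  have hd : Dense (AddSubgroup.closure ({α, β} : Set ℝ) : Set ℝ) :=
    dense_addSubgroupClosure_pair_iff.2 hαβ
  have : g = fun _ => 0 := Continuous.ext_on hd hg continuous_const fun s hs => by
    simpa [h0] using hmem s hs 0
  exact congrFun this t

/-- A function that vanishes on a hyperplane, is odd with respect to it, and is odd or even with
respect to a second hyperplane at an irrational angle vanishes near the origin. -/
lemma eq_zero_of_reflection_irrational {f : V → F} {ρ : ℝ} {θ₁ θ₂ : V} (hθ₁ : ‖θ₁‖ = 1)
    (hθ₂ : ‖θ₂‖ = 1) (hθ : Irrational (Real.arccos ⟪θ₁, θ₂⟫_ℝ / Real.pi))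
    (hf : ContinuousOn f (ball 0 ρ))
    (h0 : ∀ x ∈ ball (0 : V) ρ, ⟪x, θ₁⟫_ℝ = 0 → f x = 0)
    (h1 : ∀ x ∈ ball (0 : V) ρ, f ((ℝ ∙ θ₁)ᗮ.reflection x) = 0 ↔ f x = 0)
    (h2 : ∀ x ∈ ball (0 : V) ρ, f ((ℝ ∙ θ₂)ᗮ.reflection x) = 0 ↔ f x = 0) :
    ∀ x ∈ ball (0 : V) ρ, f x = 0 := by
  intro x hx
  set α := Real.arccos ⟪θ₁, θ₂⟫_ℝ with hα
  have hcos : Real.cos α = ⟪θ₁, θ₂⟫_ℝ := by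
    have := abs_real_inner_le_norm θ₁ θ₂
    rw [hθ₁, hθ₂, mul_one, abs_le] at this
    exact Real.cos_arccos this.1 this.2
  have hsin : Real.sin α ≠ 0 := by
    intro h
    obtain ⟨m, hm⟩ := Real.sin_eq_zero_iff.1 h
    rw [← hm, mul_div_assoc, div_self Real.pi_ne_zero, mul_one] at hθ
    exact m.not_irrational hθ
  have h11 : ⟪θ₁, θ₁⟫_ℝ = 1 := by rw [real_inner_self_eq_norm_sq, hθ₁, one_pow]
  have h22 : ⟪θ₂, θ₂⟫_ℝ = 1 := by rw [real_inner_self_eq_norm_sq, hθ₂, one_pow]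
  -- Here e is the unit vector orthogonal to θ₁ in the plane of θ₁ and θ₂.
  obtain ⟨e, he⟩ : ∃ e, θ₂ = Real.sin α • e + Real.cos α • θ₁ :=
    ⟨(Real.sin α)⁻¹ • (θ₂ - Real.cos α • θ₁), by
      rw [smul_smul, mul_inv_cancel₀ hsin, one_smul, sub_add_cancel]⟩
  have he1 : ⟪e, θ₁⟫_ℝ = 0 := by
    have : ⟪θ₁, θ₂⟫_ℝ = Real.cos α := hcos.symm
    rw [he, inner_add_right, inner_smul_right, inner_smul_right, h11, mul_one,
      add_eq_right] at this
    rw [real_inner_comm]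
    exact (mul_eq_zero.1 this).resolve_left hsin
  have hee : ⟪e, e⟫_ℝ = 1 := by
    rw [he] at h22
    simp only [inner_add_left, inner_add_right, inner_smul_left, inner_smul_right, he1, h11,
      real_inner_comm e θ₁, RCLike.conj_to_real] at h22
    have hs := Real.sin_sq_add_cos_sq α
    have : Real.sin α ^ 2 * (⟪e, e⟫_ℝ - 1) = 0 := by linarith
    have := (mul_eq_zero.1 this).resolve_left (pow_ne_zero 2 hsin)
    linarith
  set z : ℂ := ⟨⟪x, e⟫_ℝ, ⟪x, θ₁⟫_ℝ⟩ with hz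
  set r := ‖z‖ with hr
  set w := x - ⟪x, e⟫_ℝ • e - ⟪x, θ₁⟫_ℝ • θ₁ with hw
  have hwe : ⟪w, e⟫_ℝ = 0 := by
    simp only [hw, inner_sub_left, inner_smul_left, hee, real_inner_comm e θ₁, he1,
      RCLike.conj_to_real]
    ring
  have hw1 : ⟪w, θ₁⟫_ℝ = 0 := by
    simp only [hw, inner_sub_left, inner_smul_left, h11, he1, RCLike.conj_to_real]
    ring
  set c : ℝ → V := fun t => w + (r * Real.cos t) • e + (r * Real.sin t) • θ₁ with hc
  have hcx : c z.arg = x := by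
    have h1 : r * Real.cos z.arg = ⟪x, e⟫_ℝ := Complex.norm_mul_cos_arg z
    have h2 : r * Real.sin z.arg = ⟪x, θ₁⟫_ℝ := Complex.norm_mul_sin_arg z
    simp only [hc, h1, h2, hw]
    abel
  have hcn : ∀ t, ⟪c t, c t⟫_ℝ = ⟪w, w⟫_ℝ + r ^ 2 := by
    intro t
    simp only [hc, inner_add_left, inner_add_right, inner_smul_left, inner_smul_right, he1, h11,
      hee, real_inner_comm e θ₁, real_inner_comm w e, hwe, hw1, real_inner_comm w θ₁,
      RCLike.conj_to_real]
    have hs := Real.sin_sq_add_cos_sq t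
    linear_combination r ^ 2 * hs
  have hcball : ∀ t, c t ∈ ball (0 : V) ρ := by
    intro t
    have : ‖c t‖ = ‖x‖ := by
      rw [← hcx, norm_eq_sqrt_real_inner, norm_eq_sqrt_real_inner, hcn, hcn]
    rw [mem_ball, dist_zero_right] at hx ⊢
    rwa [this]
  have hc1 : ∀ t, ⟪c t, θ₁⟫_ℝ = r * Real.sin t := by
    intro t
    simp only [hc, inner_add_left, inner_smul_left, he1, h11, hw1, RCLike.conj_to_real]
    ring
  have hce : ∀ t, ⟪c t, e⟫_ℝ = r * Real.cos t := by
    intro t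
    simp only [hc, inner_add_left, inner_smul_left, real_inner_comm e θ₁, he1, hee, hwe,
      RCLike.conj_to_real]
    ring
  have hσ1 : ∀ t, (ℝ ∙ θ₁)ᗮ.reflection (c t) = c (-t) := by
    intro t
    rw [reflection_orthogonal_span_singleton_apply hθ₁, hc1]
    simp only [hc, Real.cos_neg, Real.sin_neg]
    module
  have hσ2 : ∀ t, (ℝ ∙ θ₂)ᗮ.reflection (c t) = c (-(t + 2 * α)) := by
    intro t
    rw [reflection_orthogonal_span_singleton_apply hθ₂]
    have h3 : ⟪c t, θ₂⟫_ℝ = r * Real.sin (t + α) := by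
      rw [he, inner_add_right, inner_smul_right, inner_smul_right, hc1, hce, Real.sin_add]
      ring
    have hA : Real.cos (t + 2 * α)
        = Real.cos t - 2 * Real.sin (t + α) * Real.sin α := by
      rw [show t + 2 * α = (t + α) + α by ring, show Real.cos t = Real.cos ((t + α) - α) by simp,
        Real.cos_add (t + α), Real.cos_sub]
      ring
    have hB : -Real.sin (t + 2 * α)
        = Real.sin t - 2 * Real.sin (t + α) * Real.cos α := by
      rw [show t + 2 * α = (t + α) + α by ring, show Real.sin t = Real.sin ((t + α) - α) by simp,
        Real.sin_add (t + α), Real.sin_sub]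
      ring
    rw [h3, he]
    simp only [hc, Real.cos_neg, Real.sin_neg, hA, hB]
    module
  have hcc : Continuous c := by fun_prop
  rw [← hcx]
  -- One translation is the product of the reflections, the other the period 2π; the point at angle
  -- 0 lies on the first hyperplane.
  refine eq_zero_of_irrational_translation (g := f ∘ c) (α := 2 * α) (β := 2 * Real.pi)
    (hf.comp_continuous hcc hcball) (by rwa [mul_div_mul_left _ _ two_ne_zero])
    (h0 _ (hcball 0) (by simp [hc1])) (fun t => ?_) (fun t => ?_) _
  · simp only [Function.comp_apply]
    rw [← h1 _ (hcball _), hσ1, ← hσ2, h2 _ (hcball _)]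
  · simp [hc]

variable [NormedSpace ℝ F]

lemma fderiv_comp_linearIsometryEquiv_apply {f : V → F} (L : V ≃ₗᵢ[ℝ] V) {x : V}
    (hf : DifferentiableAt ℝ f (L x)) (v : V) :
    fderiv ℝ (fun y => f (L y)) x v = fderiv ℝ f (L x) (L v) := by
  have h := hf.hasFDerivAt.comp x L.toContinuousLinearEquiv.hasFDerivAt
  change HasFDerivAt (fun y => f (L y)) _ x at h
  rw [h.fderiv]
  rfl

variable [FiniteDimensional ℝ V]

namespace InnerProductSpace

/-- The Laplacian at L y may be computed in the image under L of any orthonormal basis. -/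
lemma HarmonicAt.comp_linearIsometryEquiv {f : V → F} (L : V ≃ₗᵢ[ℝ] V) {x : V}
    (hf : HarmonicAt f (L x)) : HarmonicAt (fun y => f (L y)) x := by
  have hC : ∀ {y}, ContDiffAt ℝ 2 f (L y) → ContDiffAt ℝ 2 (fun y => f (L y)) y := fun h =>
    h.comp _ L.contDiff.contDiffAt
  refine ⟨hC hf.1, ?_⟩
  have hev := L.continuous.continuousAt.eventually hf.eventually
  filter_upwards [hev.eventually_nhds] with y hy
  have hy0 : HarmonicAt f (L y) := hy.self_of_nhds
  set b := stdOrthonormalBasis ℝ V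
  rw [laplacian_eq_sum_fderiv b (hC hy0.1)]
  have hz : Laplacian.laplacian f (L y) = 0 := hy0.2.self_of_nhds
  rw [laplacian_eq_sum_fderiv (b.map L) hy0.1] at hz
  rw [Pi.zero_apply, ← hz]
  refine Finset.sum_congr rfl fun i _ => ?_
  have h1 : (fun z => fderiv ℝ (fun z => f (L z)) z (b i)) =ᶠ[𝓝 y]
      fun z => (fun w => fderiv ℝ f w (L (b i))) (L z) := by
    filter_upwards [hy] with z hz
    exact fderiv_comp_linearIsometryEquiv_apply L (hz.1.differentiableAt (by simp)) _
  rw [h1.fderiv_eq, fderiv_comp_linearIsometryEquiv_apply (f := fun w => fderiv ℝ f w (L (b i))) L]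
  · simp
  · exact ((hy0.1.fderiv_right (m := 1) (by norm_num)).clm_apply
      contDiffAt_const).differentiableAt (by simp)

variable [CompleteSpace F]

/-- The Schwarz reflection principle: a harmonic function vanishing on a hyperplane is odd with
respect to it. -/
lemma HarmonicOnNhd.eventually_reflection_eq_neg {f : V → F} {R : ℝ} (hR : 0 < R) {n : V}
    (hn : ‖n‖ = 1) (hf : HarmonicOnNhd f (ball 0 R))
    (h0 : ∀ x ∈ ball (0 : V) R, ⟪x, n⟫_ℝ = 0 → f x = 0) :
    ∀ᶠ x in 𝓝 0, f ((ℝ ∙ n)ᗮ.reflection x) = -f x := by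
  set σ := (ℝ ∙ n)ᗮ.reflection with hσ
  have hσball : ∀ x ∈ ball (0 : V) R, σ x ∈ ball (0 : V) R := fun x hx => by simpa using hx
  have hfix : ∀ x : V, ⟪x, n⟫_ℝ = 0 → σ x = x := fun x hx => by
    rw [hσ, reflection_orthogonal_span_singleton_apply hn, hx]; simp
  have hσn : σ n = -n := by
    rw [hσ, reflection_orthogonal_span_singleton_apply hn, real_inner_self_eq_norm_sq, hn]
    module
  -- On the hyperplane both summands vanish, and their normal derivatives cancel because σ n = -n.
  have hv : HarmonicOnNhd (f + fun x => f (σ x)) (ball 0 R) := hf.add fun x hx =>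
    (hf _ (hσball x hx)).comp_linearIsometryEquiv σ
  have := hv.eventuallyEq_zero_of_cauchy_data hR hn
    (fun x hx hxn => by simp [hfix x hxn, h0 x hx hxn]) (fun x hx hxn => by
      have hd := (hf x hx).1.differentiableAt (by simp : (2 : WithTop ℕ∞) ≠ 0)
      have hd2 := (hf _ (hσball x hx)).1.differentiableAt (by simp : (2 : WithTop ℕ∞) ≠ 0)
      have hdσ : DifferentiableAt ℝ (fun y => f (σ y)) x :=
        hd2.comp x σ.differentiable.differentiableAt
      rw [fderiv_add hd hdσ,
        _root_.add_apply, fderiv_comp_linearIsometryEquiv_apply σ hd2, hσn,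
        hfix x hxn, map_neg, add_neg_cancel])
  filter_upwards [this] with x hx
  exact eq_neg_of_add_eq_zero_right hx

/-- A harmonic function whose normal derivative vanishes on a hyperplane is even with respect to
it. -/
lemma HarmonicOnNhd.eventually_reflection_eq {f : V → F} {R : ℝ} (hR : 0 < R) {n : V}
    (hn : ‖n‖ = 1) (hf : HarmonicOnNhd f (ball 0 R))
    (h0 : ∀ x ∈ ball (0 : V) R, ⟪x, n⟫_ℝ = 0 → fderiv ℝ f x n = 0) :
    ∀ᶠ x in 𝓝 0, f ((ℝ ∙ n)ᗮ.reflection x) = f x := by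
  set σ := (ℝ ∙ n)ᗮ.reflection with hσ
  have hσball : ∀ x ∈ ball (0 : V) R, σ x ∈ ball (0 : V) R := fun x hx => by simpa using hx
  have hfix : ∀ x : V, ⟪x, n⟫_ℝ = 0 → σ x = x := fun x hx => by
    rw [hσ, reflection_orthogonal_span_singleton_apply hn, hx]; simp
  have hσn : σ n = -n := by
    rw [hσ, reflection_orthogonal_span_singleton_apply hn, real_inner_self_eq_norm_sq, hn]
    module
  -- Here the values cancel on the hyperplane, and both normal derivatives vanish by hypothesis.
  have hv : HarmonicOnNhd (f - fun x => f (σ x)) (ball 0 R) := hf.sub fun x hx =>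
    (hf _ (hσball x hx)).comp_linearIsometryEquiv σ
  have := hv.eventuallyEq_zero_of_cauchy_data hR hn
    (fun x hx hxn => by simp [hfix x hxn]) (fun x hx hxn => by
      have hd := (hf x hx).1.differentiableAt (by simp : (2 : WithTop ℕ∞) ≠ 0)
      have hd2 := (hf _ (hσball x hx)).1.differentiableAt (by simp : (2 : WithTop ℕ∞) ≠ 0)
      have hdσ : DifferentiableAt ℝ (fun y => f (σ y)) x :=
        hd2.comp x σ.differentiable.differentiableAt
      rw [fderiv_sub hd hdσ,
        _root_.sub_apply, fderiv_comp_linearIsometryEquiv_apply σ hd2, hσn,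
        hfix x hxn, map_neg, h0 x hx hxn]
      simp)
  filter_upwards [this] with x hx
  exact (sub_eq_zero.1 hx).symm

/-- A harmonic function vanishing on a hyperplane, and vanishing or having vanishing normal
derivative on another hyperplane at an irrational angle, is zero. -/
theorem HarmonicOnNhd.eq_zero_of_irrational_angle {f : V → F} {Ω : Set V}
    (hf : HarmonicOnNhd f Ω) (hΩ : IsOpen Ω) (hΩc : IsPreconnected Ω) (h0 : (0 : V) ∈ Ω)
    {θ₁ θ₂ : V} (hθ₁ : ‖θ₁‖ = 1) (hθ₂ : ‖θ₂‖ = 1)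
    (hθ : Irrational (Real.arccos ⟪θ₁, θ₂⟫_ℝ / Real.pi))
    (h1 : ∀ x ∈ Ω, ⟪x, θ₁⟫_ℝ = 0 → f x = 0)
    (h2 : (∀ x ∈ Ω, ⟪x, θ₂⟫_ℝ = 0 → f x = 0) ∨
      ∀ x ∈ Ω, ⟪x, θ₂⟫_ℝ = 0 → fderiv ℝ f x θ₂ = 0) : ∀ x ∈ Ω, f x = 0 := by
  obtain ⟨R, hR, hRΩ⟩ := Metric.isOpen_iff.1 hΩ 0 h0
  have hfR := hf.mono hRΩ
  have e1 : ∀ᶠ x in 𝓝 0, f ((ℝ ∙ θ₁)ᗮ.reflection x) = 0 ↔ f x = 0 := by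
    filter_upwards [hfR.eventually_reflection_eq_neg hR hθ₁ fun x hx => h1 x (hRΩ hx)] with x hx
    rw [hx, neg_eq_zero]
  have e2 : ∀ᶠ x in 𝓝 0, f ((ℝ ∙ θ₂)ᗮ.reflection x) = 0 ↔ f x = 0 := by
    rcases h2 with h2 | h2
    · filter_upwards [hfR.eventually_reflection_eq_neg hR hθ₂ fun x hx => h2 x (hRΩ hx)] with x hx
      rw [hx, neg_eq_zero]
    · filter_upwards [hfR.eventually_reflection_eq hR hθ₂ fun x hx => h2 x (hRΩ hx)] with x hx
      rw [hx]
  obtain ⟨ρ, hρ, h⟩ := Metric.eventually_nhds_iff_ball.1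
    ((hΩ.eventually_mem h0).and (e1.and e2))
  refine hf.eqOn_zero_of_preconnected hΩ hΩc h0 (eventually_of_mem (ball_mem_nhds 0 hρ)
    (eq_zero_of_reflection_irrational hθ₁ hθ₂ hθ (hf.continuousOn.mono fun x hx => (h x hx).1)
      (fun x hx => h1 x (h x hx).1) (fun x hx => (h x hx).2.1) fun x hx => (h x hx).2.2))

end InnerProductSpace

end Reflection

/-! ### Lifting Helmholtz solutions to harmonic functions -/

section Helmholtz

variable {E : Type*} [NormedAddCommGroup E] [InnerProductSpace ℝ E]
  {F : Type*} [NormedAddCommGroup F] [NormedSpace ℝ F]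

/-- The extension of `u` to one more dimension that turns solutions of the Helmholtz equation with
parameter `k` into harmonic functions. -/
noncomputable def helmholtzLift (k : ℝ) (u : E → F) (z : WithLp 2 (E × ℝ)) : F :=
  Real.exp (k * z.snd) • u z.fst

lemma hasFDerivAt_helmholtzLift (k : ℝ) {u : E → F} {z : WithLp 2 (E × ℝ)}
    (hu : DifferentiableAt ℝ u z.fst) :
    HasFDerivAt (helmholtzLift k u)
      (Real.exp (k * z.snd) • (fderiv ℝ u z.fst).comp (WithLp.fstL 2 ℝ E ℝ)
        + (Real.exp (k * z.snd) • k • WithLp.sndL 2 ℝ E ℝ).smulRight (u z.fst)) z := by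
  have h1 : HasFDerivAt (fun z : WithLp 2 (E × ℝ) => z.fst) (WithLp.fstL 2 ℝ E ℝ) z :=
    (WithLp.fstL 2 ℝ E ℝ).hasFDerivAt
  have h2 : HasFDerivAt (fun z : WithLp 2 (E × ℝ) => z.snd) (WithLp.sndL 2 ℝ E ℝ) z :=
    (WithLp.sndL 2 ℝ E ℝ).hasFDerivAt
  exact (h2.const_mul k).exp.smul (hu.hasFDerivAt.comp z h1)

lemma fderiv_helmholtzLift_apply (k : ℝ) {u : E → F} {z : WithLp 2 (E × ℝ)}
    (hu : DifferentiableAt ℝ u z.fst) (v : WithLp 2 (E × ℝ)) :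
    fderiv ℝ (helmholtzLift k u) z v
      = helmholtzLift k (fun x => fderiv ℝ u x v.fst) z + (k * v.snd) • helmholtzLift k u z := by
  rw [(hasFDerivAt_helmholtzLift k hu).fderiv]
  simp [helmholtzLift, smul_smul]
  congr 1
  ring

variable [FiniteDimensional ℝ E]

open InnerProductSpace in
-- In an orthonormal basis adapted to the product, the extra variable contributes k² U, so the
-- Laplacian of the lift is exp(k s) (Δu + k² u).
lemma harmonicAt_helmholtzLift {k : ℝ} {u : E → F} {Ω : Set E} (hΩ : IsOpen Ω)
    (hu : ContDiffOn ℝ 2 u Ω) (hpde : ∀ x ∈ Ω, Laplacian.laplacian u x + (k ^ 2) • u x = 0)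
    {z : WithLp 2 (E × ℝ)} (hz : z.fst ∈ Ω) : HarmonicAt (helmholtzLift k u) z := by
  have huA : ∀ x ∈ Ω, ContDiffAt ℝ 2 u x := fun x hx => hu.contDiffAt (hΩ.mem_nhds hx)
  have hC : ∀ y : WithLp 2 (E × ℝ), y.fst ∈ Ω → ContDiffAt ℝ 2 (helmholtzLift k u) y := by
    intro y hy
    have h1 : ContDiffAt ℝ 2 (fun z : WithLp 2 (E × ℝ) => z.fst) y :=
      (WithLp.fstL 2 ℝ E ℝ).contDiff.contDiffAt
    have h2 : ContDiffAt ℝ 2 (fun z : WithLp 2 (E × ℝ) => z.snd) y :=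
      (WithLp.sndL 2 ℝ E ℝ).contDiff.contDiffAt
    exact (contDiffAt_const.mul h2).exp.smul ((huA _ hy).comp y h1)
  have hev : ∀ y : WithLp 2 (E × ℝ), y.fst ∈ Ω → ∀ᶠ y' in 𝓝 y, y'.fst ∈ Ω := fun y hy =>
    (WithLp.fstL 2 ℝ E ℝ).continuous.continuousAt.eventually (hΩ.eventually_mem hy)
  refine ⟨hC z hz, ?_⟩
  filter_upwards [hev z hz] with y hy
  set b := stdOrthonormalBasis ℝ E
  set B := b.prod (OrthonormalBasis.singleton (Fin 1) ℝ) with hB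
  rw [laplacian_eq_sum_fderiv B (hC y hy)]
  have hdu : ∀ a : E, DifferentiableAt ℝ (fun x => fderiv ℝ u x a) y.fst := fun a =>
    (((huA _ hy).fderiv_right (m := 1) (by norm_num)).clm_apply
      contDiffAt_const).differentiableAt (by simp)
  have hu1 : DifferentiableAt ℝ u y.fst := (huA _ hy).differentiableAt (by simp)
  have hsecond : ∀ v : WithLp 2 (E × ℝ),
      fderiv ℝ (fun z => fderiv ℝ (helmholtzLift k u) z v) y v
        = helmholtzLift k (fun x => fderiv ℝ (fun x => fderiv ℝ u x v.fst) x v.fst) y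
          + (2 * (k * v.snd)) • helmholtzLift k (fun x => fderiv ℝ u x v.fst) y
          + (k * v.snd) ^ 2 • helmholtzLift k u y := by
    intro v
    have h1 : (fun z => fderiv ℝ (helmholtzLift k u) z v) =ᶠ[𝓝 y] fun z =>
        helmholtzLift k (fun x => fderiv ℝ u x v.fst) z + (k * v.snd) • helmholtzLift k u z := by
      filter_upwards [hev y hy] with z hz
      exact fderiv_helmholtzLift_apply k ((huA _ hz).differentiableAt (by simp)) v
    have d1 := (hasFDerivAt_helmholtzLift k (hdu v.fst)).differentiableAt
    have d2 := (hasFDerivAt_helmholtzLift k hu1).differentiableAt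
    rw [h1.fderiv_eq, fderiv_fun_add d1 (d2.fun_const_smul _), fderiv_fun_const_smul d2,
      _root_.add_apply, _root_.smul_apply,
      fderiv_helmholtzLift_apply k (hdu v.fst), fderiv_helmholtzLift_apply k hu1]
    module
  simp_rw [hsecond]
  rw [Fintype.sum_sum_type]
  have hp := hpde _ hy
  rw [laplacian_eq_sum_fderiv b (huA _ hy)] at hp
  have := congrArg (fun w => Real.exp (k * y.snd) • w) hp
  simpa [hB, helmholtzLift, Finset.smul_sum, smul_comm (k ^ 2)] using this

end Helmholtz

end

/-! ### The main theorem -/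

theorem theoremA {𝕜 : Type*} [RCLike 𝕜] (d : ℕ) (hd : 2 ≤ d)
    (Ω : Set (EuclideanSpace ℝ (Fin d))) (hΩ_open : IsOpen Ω) (hΩ_conn : IsConnected Ω)
    (h0 : (0 : EuclideanSpace ℝ (Fin d)) ∈ Ω)
    (θ₁ θ₂ : EuclideanSpace ℝ (Fin d)) (hθ₁ : ‖θ₁‖ = 1) (hθ₂ : ‖θ₂‖ = 1)
    (hθ : ¬ ∃ q : ℚ, Real.arccos ⟪θ₁, θ₂⟫_ℝ = Real.pi * (q : ℝ))
    (k : ℝ) (u : EuclideanSpace ℝ (Fin d) → 𝕜)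
    (hu : ContDiffOn ℝ 2 u Ω)
    (hpde : ∀ x ∈ Ω, Laplacian.laplacian u x + (k ^ 2) • u x = 0)
    (hbc : ((∀ x ∈ Ω, x ∈ (ℝ ∙ θ₁)ᗮ → u x = 0) ∧ (∀ x ∈ Ω, x ∈ (ℝ ∙ θ₂)ᗮ → u x = 0)) ∨
      ((∀ x ∈ Ω, x ∈ (ℝ ∙ θ₁)ᗮ → u x = 0) ∧
        (∀ x ∈ Ω, x ∈ (ℝ ∙ θ₂)ᗮ → fderiv ℝ u x θ₂ = 0))) :
    ∀ x ∈ Ω, u x = 0 := by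
  set U := helmholtzLift k u with hU
  set Ω' : Set (WithLp 2 (EuclideanSpace ℝ (Fin d) × ℝ)) := {z | z.fst ∈ Ω} with hΩ'
  have hopen : IsOpen Ω' := hΩ_open.preimage (WithLp.fstL 2 ℝ _ ℝ).continuous
  have hconn : IsPreconnected Ω' := by
    have h := (hΩ_conn.isPreconnected.prod (isPreconnected_univ (α := ℝ))).image _
      (WithLp.prodContinuousLinearEquiv 2 ℝ
        (EuclideanSpace ℝ (Fin d)) ℝ).symm.continuous.continuousOn
    convert h using 1
    ext z
    simp [hΩ', ContinuousLinearEquiv.image_symm_eq_preimage]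
  have hharm : InnerProductSpace.HarmonicOnNhd U Ω' := fun z hz => harmonicAt_helmholtzLift hΩ_open hu hpde hz
  have hirr : Irrational (Real.arccos ⟪θ₁, θ₂⟫_ℝ / Real.pi) := by
    rintro ⟨q, hq⟩
    exact hθ ⟨q, by rw [hq, mul_div_cancel₀ _ Real.pi_ne_zero]⟩
  -- Normals are embedded with last coordinate 0. This keeps their angle, and the term from
  -- differentiating the exponential drops out of the normal derivative.
  set ι : EuclideanSpace ℝ (Fin d) → WithLp 2 (EuclideanSpace ℝ (Fin d) × ℝ) :=
    fun x => WithLp.toLp 2 (x, 0) with hι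
  have hinner : ∀ (z : WithLp 2 (EuclideanSpace ℝ (Fin d) × ℝ)) (θ : EuclideanSpace ℝ (Fin d)),
      ⟪z, ι θ⟫_ℝ = ⟪z.fst, θ⟫_ℝ := fun z θ => by simp [hι, WithLp.prod_inner_apply]
  have hnorm : ∀ θ : EuclideanSpace ℝ (Fin d), ‖θ‖ = 1 → ‖ι θ‖ = 1 := fun θ h => by
    rw [norm_eq_sqrt_real_inner, hinner]
    simp [hι, h]
  have hdir : ∀ θ : EuclideanSpace ℝ (Fin d), (∀ x ∈ Ω, x ∈ (ℝ ∙ θ)ᗮ → u x = 0) →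
      ∀ z ∈ Ω', ⟪z, ι θ⟫_ℝ = 0 → U z = 0 := fun θ h z hz hzθ => by
    rw [hinner, real_inner_comm] at hzθ
    rw [hU, helmholtzLift, h _ hz (Submodule.mem_orthogonal_singleton_iff_inner_right.2 hzθ),
      smul_zero]
  have hneu : ∀ θ : EuclideanSpace ℝ (Fin d), (∀ x ∈ Ω, x ∈ (ℝ ∙ θ)ᗮ → fderiv ℝ u x θ = 0) →
      ∀ z ∈ Ω', ⟪z, ι θ⟫_ℝ = 0 → fderiv ℝ U z (ι θ) = 0 := fun θ h z hz hzθ => by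
    rw [hinner, real_inner_comm] at hzθ
    rw [hU, fderiv_helmholtzLift_apply k
      ((hu.contDiffAt (hΩ_open.mem_nhds hz)).differentiableAt (by simp))]
    simp [hι, helmholtzLift, h _ hz (Submodule.mem_orthogonal_singleton_iff_inner_right.2 hzθ)]
  have hmain := hharm.eq_zero_of_irrational_angle hopen hconn (θ₁ := ι θ₁) (θ₂ := ι θ₂)
    (by simpa [hΩ'] using h0) (hnorm _ hθ₁) (hnorm _ hθ₂) (by rw [hinner]; exact hirr)
    (hdir _ (hbc.elim And.left And.left))
    (hbc.imp (fun h => hdir _ h.2) fun h => hneu _ h.2)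
  intro x hx
  exact (smul_eq_zero.1 (hmain (ι x) hx)).resolve_left (Real.exp_pos _).ne'
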